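/- Let $K$ be a field (of any characteristic), let $n\ge 1$ be an integer and let $p\in K[X]$ be a polynomial. Let $Q$ be the quiver with vertices $0,1,\dots,n-1$, a loop $\epsilon$ at the vertex $0$, and, for $0\le i\le n-2$, arrows $a_i\colon i\to i+1$ and $\overline a_i\colon i+1\to i$. The deformed preprojective algebra $L_n^p$ of type $L_n$ is the quotient of the path algebra $KQ$ (paths are composed from left to right) by the two-sided ideal generated by the relations $$a_s\overline a_s+\overline a_{s-1}a_{s-1}=0\quad(1\le s\le n-2),\qquad \overline a_{n-2}a_{n-2}=0,\qquad \epsilon^{2n}=0,\qquad \epsilon^2+a_0\overline a_0+\epsilon^3p(\epsilon)=0.$$ (For $n=1$ there are no arrows $a_i,\overline a_i$; terms containing them are read as zero.) Then $L_n^p$ is a symmetric algebra, that is, $L_n^p$ is finite-dimensional over $K$ and is isomorphic to its dual space $\operatorname{Hom}_K(L_n^p,K)$ as an $L_n^p$-$L_n^p$-bimodule, where $(b\cdot f\cdot c)(x)=f(cxb)$. -/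

import Mathlib

open Polynomial

/-- A path of the quiver `V`, together with its source and its target. The trivial paths
`Quiver.Path.nil` at the vertices are included. -/
structure QPath (V : Type*) [Quiver V] where
  src : V
  tgt : V
  path : Quiver.Path src tgt

namespace QPath

variable {V : Type*} [Quiver V]

/-- The trivial path at the vertex `v`. -/
def trivial (v : V) : QPath V := ⟨v, v, Quiver.Path.nil⟩

/-- The path of length one given by an arrow. -/
def ofArrow {v w : V} (α : v ⟶ w) : QPath V := ⟨v, w, α.toPath⟩

open Classical in
/-- Concatenation, first `p` and then `q`; it is `none` unless `p` ends where `q` starts. -/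
noncomputable def concat (p q : QPath V) : Option (QPath V) :=
  if h : p.tgt = q.src then some ⟨p.src, q.tgt, (p.path.cast rfl h).comp q.path⟩ else none

theorem concat_mk {u v w : V} (p : Quiver.Path u v) (q : Quiver.Path v w) :
    concat ⟨u, v, p⟩ ⟨v, w, q⟩ = some ⟨u, w, p.comp q⟩ := by
  simp [concat]

theorem concat_of_ne {p q : QPath V} (h : p.tgt ≠ q.src) : concat p q = none := by
  simp [concat, h]

theorem concat_assoc (p q r : QPath V) :
    (concat p q).bind (fun s => concat s r) = (concat q r).bind (fun s => concat p s) := by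
  obtain ⟨a, b, p⟩ := p
  obtain ⟨c, d, q⟩ := q
  obtain ⟨e, f, r⟩ := r
  by_cases h1 : b = c
  · subst h1
    by_cases h2 : d = e
    · subst h2
      simp [concat_mk]
    · rw [concat_mk, concat_of_ne (p := ⟨b, d, q⟩) h2]
      simpa using concat_of_ne (p := ⟨a, d, p.comp q⟩) (q := ⟨e, f, r⟩) h2
  · rw [concat_of_ne (p := ⟨a, b, p⟩) (q := ⟨c, d, q⟩) h1]
    by_cases h2 : d = e
    · subst h2
      rw [concat_mk]
      simpa using (concat_of_ne (p := ⟨a, b, p⟩) (q := ⟨c, f, q.comp r⟩) h1).symm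
    · rw [concat_of_ne (p := ⟨c, d, q⟩) (q := ⟨e, f, r⟩) h2]
      simp

end QPath

/-- The path algebra of the quiver `V` over `K`: the vector space with basis the paths of `V`.
Paths are multiplied by concatenation, read from left to right; the product of two paths that
cannot be concatenated is zero. -/
def PathAlgebra (K : Type*) (V : Type*) [CommRing K] [Quiver V] : Type _ := QPath V →₀ K

namespace PathAlgebra

variable {K V : Type*} [CommRing K] [Quiver V]

noncomputable instance : AddCommGroup (PathAlgebra K V) :=
  inferInstanceAs (AddCommGroup (QPath V →₀ K))

noncomputable instance : Module K (PathAlgebra K V) :=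
  inferInstanceAs (Module K (QPath V →₀ K))

/-- The basis element of the path algebra given by a path. -/
noncomputable def of (p : QPath V) : PathAlgebra K V := Finsupp.single p (1 : K)

/-- The product of two paths. -/
noncomputable def mulPath (K : Type*) {V : Type*} [CommRing K] [Quiver V] (p q : QPath V) :
    PathAlgebra K V :=
  (QPath.concat p q).elim 0 of

/-- The bilinear extension of the product of paths. -/
noncomputable def mulHom (K V : Type*) [CommRing K] [Quiver V] :
    PathAlgebra K V →ₗ[K] PathAlgebra K V →ₗ[K] PathAlgebra K V :=
  Finsupp.linearCombination K (fun p : QPath V =>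
    (Finsupp.linearCombination K (fun q : QPath V => mulPath K p q) :
      PathAlgebra K V →ₗ[K] PathAlgebra K V))

noncomputable instance : Mul (PathAlgebra K V) := ⟨fun x y => mulHom K V x y⟩

/-- The sum of the trivial paths at all vertices. -/
noncomputable instance [Fintype V] : One (PathAlgebra K V) :=
  ⟨∑ v : V, of (QPath.trivial v)⟩

theorem mul_def (x y : PathAlgebra K V) : x * y = mulHom K V x y := rfl

theorem one_def [Fintype V] : (1 : PathAlgebra K V) = ∑ v : V, of (QPath.trivial v) := rfl

theorem of_mul_of (p q : QPath V) : (of p * of q : PathAlgebra K V) = mulPath K p q := by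
  have h1 : mulHom K V (of p) = (Finsupp.linearCombination K (fun q : QPath V => mulPath K p q) :
      PathAlgebra K V →ₗ[K] PathAlgebra K V) :=
    (Finsupp.linearCombination_single K (1 : K) p).trans (one_smul K _)
  rw [mul_def, h1]
  exact (Finsupp.linearCombination_single K (1 : K) q).trans (one_smul K _)

theorem induction_on {P : PathAlgebra K V → Prop} (x : PathAlgebra K V) (zero : P 0)
    (add : ∀ x y, P x → P y → P (x + y)) (smul_of : ∀ (c : K) (p : QPath V), P (c • of p)) :
    P x := by
  refine Finsupp.induction_linear x zero add (fun p c => ?_)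
  have h : c • (of p : PathAlgebra K V) = Finsupp.single p c :=
    (Finsupp.smul_single c p (1 : K)).trans (by simp)
  exact h ▸ smul_of c p

noncomputable instance : NonUnitalNonAssocRing (PathAlgebra K V) where
  left_distrib x y z := by simp only [mul_def, map_add]
  right_distrib x y z := by simp only [mul_def, map_add, LinearMap.add_apply]
  zero_mul x := by simp only [mul_def, map_zero, LinearMap.zero_apply]
  mul_zero x := by simp only [mul_def, map_zero]

theorem smul_mul_aux (c : K) (x y : PathAlgebra K V) : c • x * y = c • (x * y) := by
  simp only [mul_def, map_smul, LinearMap.smul_apply]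

theorem mul_smul_aux (c : K) (x y : PathAlgebra K V) : x * c • y = c • (x * y) := by
  simp only [mul_def, map_smul]

theorem mul_assoc_aux (x y z : PathAlgebra K V) : x * y * z = x * (y * z) := by
  induction x using induction_on with
  | zero => simp
  | add x x' hx hx' => simp only [add_mul, hx, hx']
  | smul_of a p =>
    induction y using induction_on with
    | zero => simp
    | add y y' hy hy' => simp only [add_mul, mul_add, hy, hy']
    | smul_of b q =>
      induction z using induction_on with
      | zero => simp
      | add z z' hz hz' => simp only [mul_add, hz, hz']
      | smul_of c r =>
        simp only [smul_mul_aux, mul_smul_aux, of_mul_of]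
        congr 3
        have h := congrArg (fun o => o.elim (0 : PathAlgebra K V) of) (QPath.concat_assoc p q r)
        have h1 : mulPath K p q * of r =
            ((QPath.concat p q).bind (fun s => QPath.concat s r)).elim
              (0 : PathAlgebra K V) of := by
          unfold mulPath
          cases QPath.concat p q with
          | none => simp
          | some s => simp [of_mul_of, mulPath]
        have h2 : of p * mulPath K q r =
            ((QPath.concat q r).bind (fun s => QPath.concat p s)).elim
              (0 : PathAlgebra K V) of := by
          unfold mulPath
          cases QPath.concat q r with
          | none => simp
          | some s => simp [of_mul_of, mulPath]
        rw [h1, h2]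
        exact h

theorem one_mul_of [Fintype V] (p : QPath V) : (1 : PathAlgebra K V) * of p = of p := by
  rw [one_def, Finset.sum_mul, Finset.sum_eq_single p.src]
  · obtain ⟨u, v, p⟩ := p
    simp [of_mul_of, mulPath, QPath.trivial, QPath.concat_mk]
  · intro v _ hv
    rw [of_mul_of, mulPath, QPath.concat_of_ne (by exact hv), Option.elim_none]
  · simp

theorem of_mul_one [Fintype V] (p : QPath V) : of p * (1 : PathAlgebra K V) = of p := by
  rw [one_def, Finset.mul_sum, Finset.sum_eq_single p.tgt]
  · obtain ⟨u, v, p⟩ := p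
    simp [of_mul_of, mulPath, QPath.trivial, QPath.concat_mk]
  · intro v _ hv
    rw [of_mul_of, mulPath, QPath.concat_of_ne (by exact hv.symm), Option.elim_none]
  · simp

noncomputable instance [Fintype V] : Ring (PathAlgebra K V) where
  __ := (inferInstance : NonUnitalNonAssocRing (PathAlgebra K V))
  mul_assoc := mul_assoc_aux
  one_mul x := by
    induction x using induction_on with
    | zero => simp
    | add x y hx hy => rw [mul_add, hx, hy]
    | smul_of c p => rw [mul_smul_aux, one_mul_of]
  mul_one x := by
    induction x using induction_on with
    | zero => simp
    | add x y hx hy => rw [add_mul, hx, hy]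
    | smul_of c p => rw [smul_mul_aux, of_mul_one]

noncomputable instance [Fintype V] : Algebra K (PathAlgebra K V) :=
  Algebra.ofModule smul_mul_aux mul_smul_aux

end PathAlgebra

/-- The vertices `0, 1, ..., n - 1` of the quiver of type `L_n`. -/
@[ext]
structure LVertex (n : ℕ) where
  val : ℕ
  lt : val < n

instance (n : ℕ) : Fintype (LVertex n) :=
  Fintype.ofEquiv (Fin n) ⟨fun i => ⟨i.1, i.2⟩, fun v => ⟨v.1, v.2⟩, fun _ => rfl, fun _ => rfl⟩

/-- The arrows of the quiver of type `L_n`: the loop `ε` at the vertex `0` and, for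
`0 ≤ i ≤ n - 2`, the arrows `a_i : i ⟶ i + 1` and `ā_i : i + 1 ⟶ i`. -/
inductive LArrow (n : ℕ) : LVertex n → LVertex n → Type
  | eps (h : 0 < n) : LArrow n ⟨0, h⟩ ⟨0, h⟩
  | a (i : ℕ) (h : i + 1 < n) : LArrow n ⟨i, Nat.lt_of_succ_lt h⟩ ⟨i + 1, h⟩
  | abar (i : ℕ) (h : i + 1 < n) : LArrow n ⟨i + 1, h⟩ ⟨i, Nat.lt_of_succ_lt h⟩

instance (n : ℕ) : Quiver (LVertex n) := ⟨LArrow n⟩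

namespace DeformedL

variable (K : Type*) [Field K] (n : ℕ)

/-- The loop `ε`, as an element of the path algebra (zero for the empty quiver, `n = 0`). -/
noncomputable def eps : PathAlgebra K (LVertex n) :=
  if h : 0 < n then PathAlgebra.of (QPath.ofArrow (LArrow.eps h)) else 0

/-- The arrow `a_i`, as an element of the path algebra. If the quiver has no such arrow, i.e. if
`i > n - 2`, this is zero. -/
noncomputable def a (i : ℕ) : PathAlgebra K (LVertex n) :=
  if h : i + 1 < n then PathAlgebra.of (QPath.ofArrow (LArrow.a i h)) else 0

/-- The arrow `ā_i`, as an element of the path algebra. If the quiver has no such arrow, i.e. if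
`i > n - 2`, this is zero. -/
noncomputable def abar (i : ℕ) : PathAlgebra K (LVertex n) :=
  if h : i + 1 < n then PathAlgebra.of (QPath.ofArrow (LArrow.abar i h)) else 0

/-- The defining relations of `L_n^p`; `Rel K n p x y` stands for the relation `x = y`.
For `n = 1` there are no arrows `a_i`, `ā_i`, and the relations are `ε² = 0` and
`ε² + ε³ p(ε) = 0`. -/
inductive Rel (p : K[X]) : PathAlgebra K (LVertex n) → PathAlgebra K (LVertex n) → Prop
  | mesh (s : ℕ) (h₁ : 1 ≤ s) (h₂ : s + 2 ≤ n) :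
      Rel p (a K n s * abar K n s + abar K n (s - 1) * a K n (s - 1)) 0
  | last (s : ℕ) (h : s + 2 = n) : Rel p (abar K n s * a K n s) 0
  | nilpotent : Rel p (eps K n ^ (2 * n)) 0
  | deformed :
      Rel p (eps K n ^ 2 + a K n 0 * abar K n 0 + eps K n ^ 3 * aeval (eps K n) p) 0

end DeformedL

/-- The deformed preprojective algebra `L_n^p` of type `L_n`: the path algebra of the quiver of
type `L_n` modulo the two-sided ideal generated by the defining relations. -/
abbrev DeformedPreprojectiveL (K : Type*) [Field K] (n : ℕ) (p : K[X]) : Type _ :=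
  RingQuot (DeformedL.Rel K n p)

/-- A `K`-algebra `A` is a symmetric algebra (in the sense of Frobenius algebras) if it is finite-dimensional and `A` is isomorphic to its dual
space `Hom_K(A, K)` as an `A`-`A`-bimodule, where `A` acts on the dual space by
`(b • f • c) x = f (c * x * b)`. -/
def IsSelfDualSymmetricAlgebra (K A : Type*) [Field K] [Ring A] [Algebra K A] : Prop :=
  FiniteDimensional K A ∧
    ∃ φ : A ≃ₗ[K] Module.Dual K A, ∀ b y c x : A, φ (b * y * c) x = φ y (c * x * b)

/-!
The algebra `A = L_n^p` is symmetric because it carries a nondegenerate trace form, that is, a linear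
form `τ` with `τ (x * y) = τ (y * x)` such that `τ (x * y) = 0` for all `y` only if `x = 0`. The
isomorphism with the dual space then sends `x` to `τ (x * ·)`.

The form. Put `y = X² + X³ p` (`loopPoly p`). Weights `X` for the loop, `1` for `a_i` and
`(-1) ^ (i + 1) * y` for `ā_i` define a homomorphism from the path algebra to the `n × n` matrices
over `K[X]`. It respects the relations, except for `ε ^ (2 * n) = 0` and `ā_{n-2} a_{n-2} = 0` (and,
for `n = 1`, the deformed one). Compose the matrix trace with a linear form `t` on `K[X]` that
vanishes on `X ^ (2 * n) * K[X]` and on all powers of `y`, but not at `X ^ (2 * n - 1)`; it exists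
because `y ^ k` has even order `2 * k` (`exists_linearForm`). Closed paths at the last vertex have
weights in `K[y] + y ^ (n - 1) * K[X]` (`DeformedL.weight_of_src_last`), and `y ^ n` is divisible by
`X ^ (2 * n)`, so the composite also vanishes on the multiples of the remaining relations
(`DeformedL.weightTrace_mul_rel`) and descends to `A`.

Nondegeneracy. The sum `z` of the cycles `± a_i ā_i` is central in `A`, it is `y(ε)` at the vertex
`0`, and `z ^ k` vanishes at the vertex `i` as soon as `n ≤ i + k`. Since `1` and `X` generate `K[X]`
over `K[y]` modulo `X ^ (2 * n)`, the component of `A` from `i` to `j` is generated over `K[z]` by the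
shortest path `w i j` and the path `v i j` that passes the loop once (`LSystem.pathSpan_eq_top`). This
shows that `A` is finite-dimensional. Moreover `τ` vanishes at `z ^ k * w i j * w j i`, and at
`z ^ k * v i j * w j i` and `z ^ k * w i j * v j i` it has the value `τ (z ^ (k + max i j) * ε)`,
which is zero for `n ≤ k + max i j` and nonzero for `k + max i j = n - 1`. Hence an element
`f(z) * w i j + g(z) * v i j` orthogonal to `A` has `f` and `g` divisible by `X ^ (n - max i j)`, and
so is zero (`LSystem.trace_nondegenerate`).
-/

/-! ### The polynomial `X² + X³ p` -/

section Poly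
variable {K : Type*} [Field K]

/-- The polynomial `X² + X³ p`, which expresses `-a_0 ā_0` in terms of the loop `ε`. -/
noncomputable def loopPoly (p : K[X]) : K[X] := X ^ 2 + X ^ 3 * p

theorem loopPoly_pow (p : K[X]) (k : ℕ) :
    loopPoly p ^ k = X ^ (2 * k) * (1 + X * p) ^ k := by
  rw [pow_mul, ← mul_pow, loopPoly]
  ring

/-- If `X ^ (2 * n - 1)` were a polynomial `F` in `loopPoly p` modulo `X ^ (2 * n)`, then `F` would
be divisible by `X ^ n`: its lowest term has even order in `X`. -/
theorem X_pow_dvd_of_aeval_loopPoly (p : K[X]) {n : ℕ} (F h : K[X])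
    (hF : aeval (loopPoly p) F + X ^ (2 * n) * h = X ^ (2 * n - 1)) :
    ∀ k ≤ n, X ^ k ∣ F := by
  intro k
  induction k with
  | zero => simp
  | succ k ih =>
    intro hk
    obtain ⟨G, rfl⟩ := ih (by omega)
    rw [map_mul, map_pow, aeval_X, loopPoly_pow] at hF
    have h1 : (1 + X * p) ^ k * aeval (loopPoly p) G + X ^ (2 * (n - k)) * h
        = X ^ (2 * (n - k) - 1) := by
      apply mul_left_cancel₀ (pow_ne_zero (2 * k) (X_ne_zero (R := K)))
      rw [mul_add, ← mul_assoc, ← mul_assoc, ← pow_add, ← pow_add,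
        show 2 * k + 2 * (n - k) = 2 * n by omega,
        show 2 * k + (2 * (n - k) - 1) = 2 * n - 1 by omega]
      exact hF
    have h2 := congrArg (eval 0) h1
    have h3 : eval 0 (aeval (loopPoly p) G) = eval 0 G := by
      rw [← Polynomial.comp_eq_aeval, eval_comp]
      simp [loopPoly]
    rw [eval_add, eval_mul, h3] at h2
    have e1 : 2 * (n - k) ≠ 0 := by omega
    have e2 : 2 * (n - k) - 1 ≠ 0 := by omega
    simp [e1, e2] at h2
    rw [pow_succ]
    apply mul_dvd_mul_left
    rw [X_dvd_iff, coeff_zero_eq_eval_zero, h2]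

/-- The leading orders of `loopPoly p ^ k` are even, so `X ^ (2 * n - 1)` is not a combination of
these powers modulo `X ^ (2 * n)`, and a linear form separates it from them. -/
theorem exists_linearForm (p : K[X]) {n : ℕ} (hn : 1 ≤ n) :
    ∃ t : K[X] →ₗ[K] K, (∀ h, t (X ^ (2 * n) * h) = 0) ∧
      (∀ F : K[X], t (aeval (loopPoly p) F) = 0) ∧ t (X ^ (2 * n - 1)) ≠ 0 := by
  let W : Submodule K K[X] := LinearMap.range (aeval (loopPoly p) : K[X] →ₐ[K] K[X]).toLinearMap ⊔
    LinearMap.range (LinearMap.mulLeft K (X ^ (2 * n) : K[X]))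
  have hW : (X ^ (2 * n - 1) : K[X]) ∉ W := by
    intro hmem
    obtain ⟨_, ⟨F, rfl⟩, _, ⟨h, rfl⟩, hF⟩ := Submodule.mem_sup.1 hmem
    simp only [AlgHom.toLinearMap_apply, LinearMap.mulLeft_apply] at hF
    obtain ⟨G, rfl⟩ := X_pow_dvd_of_aeval_loopPoly p F h hF n le_rfl
    rw [map_mul, map_pow, aeval_X, loopPoly_pow, mul_assoc, ← mul_add] at hF
    have h1 : (X ^ (2 * n) : K[X]) ∣ X ^ (2 * n - 1) := ⟨_, hF.symm⟩
    have := (pow_dvd_pow_iff (X_ne_zero (R := K)) not_isUnit_X).1 h1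
    omega
  obtain ⟨t, ht, htW⟩ := Submodule.exists_le_ker_of_notMem hW
  refine ⟨t, fun h => htW (Submodule.mem_sup_right ⟨h, rfl⟩),
    fun F => htW (Submodule.mem_sup_left ⟨F, rfl⟩), ht⟩

/-- Modulo `X ^ (2 * n)`, the polynomial ring is spanned by `y ^ r` and `y ^ r * X`, where
`y = loopPoly p`. -/
theorem mem_of_loopPoly_pow_mem (p : K[X]) (n : ℕ) (M : Submodule K K[X])
    (h₀ : ∀ r, loopPoly p ^ r ∈ M) (h₁ : ∀ r, loopPoly p ^ r * X ∈ M)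
    (h₂ : ∀ h, X ^ (2 * n) * h ∈ M) (q : K[X]) : q ∈ M := by
  have key : ∀ d ≤ 2 * n, ∀ h, X ^ (2 * n - d) * h ∈ M := by
    intro d
    induction d with
    | zero => exact fun _ => h₂
    | succ d ih =>
      intro hd h
      have ih := ih (by omega)
      rw [show 2 * n - d = (2 * n - (d + 1)) + 1 by omega] at ih
      generalize 2 * n - (d + 1) = k at *
      -- the power of `y`, or of `y` times `X`, with leading term `X ^ k`
      have hX : ∃ g ∈ M, ∃ q, X ^ k = g + X ^ (k + 1) * q := by
        have hu (r : ℕ) : ∃ q, (1 + X * p) ^ r = 1 + X * q := by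
          obtain ⟨q, hq⟩ := sub_dvd_pow_sub_pow (1 + X * p) 1 r
          exact ⟨p * q, by linear_combination hq⟩
        obtain ⟨r, rfl | rfl⟩ := Nat.even_or_odd' k
        · obtain ⟨q, hq⟩ := hu r
          exact ⟨_, h₀ r, -q, by rw [loopPoly_pow, hq]; ring⟩
        · obtain ⟨q, hq⟩ := hu r
          exact ⟨_, h₁ r, -q, by rw [loopPoly_pow, hq]; ring⟩
      obtain ⟨g, hg, q, hq⟩ := hX
      have : X ^ k * h = h.coeff 0 • g + X ^ (k + 1) * (h.coeff 0 • q + h.divX) := by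
        nth_rewrite 1 [← divX_mul_X_add h]
        simp only [smul_eq_C_mul]
        linear_combination C (h.coeff 0) * hq
      rw [this]
      exact M.add_mem (M.smul_mem _ hg) (ih _)
  simpa using key (2 * n) le_rfl q

/-- If the pairing of `g` with all shifts of a sequence vanishes and `s N` is the last nonzero
term of the sequence, then the low coefficients of `g` vanish. -/
theorem X_pow_dvd_of_sum_shift_eq_zero {s : ℕ → K} {N m : ℕ} (hm : m ≤ N) (hN : s N ≠ 0)
    (hs : ∀ q, N < q → s q = 0) (g : K[X])
    (hg : ∀ k, ∑ r ∈ Finset.range (g.natDegree + 1), g.coeff r * s (r + k + m) = 0) :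
    X ^ (N + 1 - m) ∣ g := by
  rw [X_pow_dvd_iff]
  intro d
  induction d using Nat.strong_induction_on with
  | _ d ih =>
    intro hd
    by_cases hdg : d ≤ g.natDegree
    · have h := hg (N - m - d)
      rw [Finset.sum_eq_single d] at h
      · rw [show d + (N - m - d) + m = N by omega] at h
        exact (mul_eq_zero.1 h).resolve_right hN
      · intro r _ hr
        rcases lt_or_gt_of_ne hr with hr | hr
        · rw [ih r hr (by omega), zero_mul]
        · rw [hs _ (by omega), mul_zero]
      · intro h'
        exact absurd (Finset.mem_range.2 (by omega)) h'
    · exact coeff_eq_zero_of_natDegree_lt (by omega)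

end Poly

/-! ### Generators with relations of type `L_n` -/

/-- Elements of an algebra that satisfy the relations of the quiver algebra `L_n^p`: idempotents
`e i`, arrows `a i : i → i + 1` and `b i : i + 1 → i`, and a loop `ε` at `0`. All of them are
indexed by `ℕ`, with value zero outside of the quiver. The element `b i` stands for
`(-1) ^ (i + 1) ā_i`; this choice removes the signs from the relations, and the relation
`ā_{n-2} a_{n-2} = 0` becomes the case `i = n - 2` of `mesh`. -/
structure LSystem (A : Type*) {K : Type*} [Field K] [Ring A] [Algebra K A] (n : ℕ) (p : K[X]) where
  e : ℕ → A
  a : ℕ → A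
  b : ℕ → A
  ε : A
  e_mul_self : ∀ i, e i * e i = e i
  e_mul_of_ne : ∀ i j, i ≠ j → e i * e j = 0
  e_eq_zero : ∀ i, n ≤ i → e i = 0
  sum_e : ∑ i ∈ Finset.range n, e i = 1
  e_mul_a : ∀ i, e i * a i = a i
  a_mul_e : ∀ i, a i * e (i + 1) = a i
  e_mul_b : ∀ i, e (i + 1) * b i = b i
  b_mul_e : ∀ i, b i * e i = b i
  e_mul_ε : e 0 * ε = ε
  ε_mul_e : ε * e 0 = ε
  mesh : ∀ i, a (i + 1) * b (i + 1) = b i * a i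
  deformed : a 0 * b 0 = aeval ε (loopPoly p)
  nilpotent : ε ^ (2 * n) = 0
  generate : ∀ N : Submodule K A, (∀ i, e i ∈ N) → (∀ x ∈ N, ∀ i, x * a i ∈ N) →
    (∀ x ∈ N, ∀ i, x * b i ∈ N) → (∀ x ∈ N, x * ε ∈ N) → N = ⊤

namespace LSystem

variable {K A : Type*} [Field K] [Ring A] [Algebra K A] {n : ℕ} {p : K[X]} (S : LSystem A n p)

/-- Two elements cannot be composed if the first ends at another vertex than the second starts. -/
theorem mul_eq_zero_of_ne {x y : A} {i j : ℕ} (hx : x * S.e i = x) (hy : S.e j * y = y)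
    (h : i ≠ j) : x * y = 0 := by
  rw [← hx, ← hy, mul_assoc, ← mul_assoc (S.e i), S.e_mul_of_ne i j h, zero_mul, mul_zero]

/-! ### The central element -/

/-- The sum of the cycles `a i * b i`. It commutes with all elements of the algebra, and at the
vertex `0` it equals `loopPoly p` at `ε`. -/
def z : A := ∑ i ∈ Finset.range n, S.a i * S.b i

theorem z_mul_e (i : ℕ) : S.z * S.e i = S.a i * S.b i := by
  by_cases hi : i < n
  · rw [z, Finset.sum_mul, Finset.sum_eq_single i]
    · rw [mul_assoc, S.b_mul_e]
    · intro j _ hj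
      rw [mul_assoc, S.mul_eq_zero_of_ne (S.b_mul_e j) (S.e_mul_self i) hj, mul_zero]
    · intro h
      exact absurd (Finset.mem_range.2 hi) h
  · rw [← S.e_mul_a i, S.e_eq_zero i (not_lt.1 hi)]
    simp

theorem e_mul_z (i : ℕ) : S.e i * S.z = S.a i * S.b i := by
  by_cases hi : i < n
  · rw [z, Finset.mul_sum, Finset.sum_eq_single i]
    · rw [← mul_assoc, S.e_mul_a]
    · intro j _ hj
      rw [← mul_assoc, S.mul_eq_zero_of_ne (S.e_mul_self i) (S.e_mul_a j) hj.symm, zero_mul]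
    · intro h
      exact absurd (Finset.mem_range.2 hi) h
  · rw [← S.e_mul_a i, S.e_eq_zero i (not_lt.1 hi)]
    simp

theorem z_mul_a (i : ℕ) : S.z * S.a i = S.a i * S.z := by
  calc S.z * S.a i = S.z * S.e i * S.a i := by rw [mul_assoc, S.e_mul_a]
    _ = S.a i * (S.e (i + 1) * S.z) := by rw [S.z_mul_e, S.e_mul_z, S.mesh, mul_assoc]
    _ = S.a i * S.z := by rw [← mul_assoc, S.a_mul_e]

theorem z_mul_b (i : ℕ) : S.z * S.b i = S.b i * S.z := by
  calc S.z * S.b i = S.z * S.e (i + 1) * S.b i := by rw [mul_assoc, S.e_mul_b]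
    _ = S.b i * (S.e i * S.z) := by rw [S.z_mul_e, S.e_mul_z, S.mesh, mul_assoc]
    _ = S.b i * S.z := by rw [← mul_assoc, S.b_mul_e]

theorem z_mul_e_zero : S.z * S.e 0 = aeval S.ε (loopPoly p) := by rw [S.z_mul_e, S.deformed]

theorem e_zero_mul_z : S.e 0 * S.z = aeval S.ε (loopPoly p) := by rw [S.e_mul_z, S.deformed]

theorem z_mul_ε : S.z * S.ε = S.ε * S.z := by
  have h : aeval S.ε (loopPoly p) * S.ε = S.ε * aeval S.ε (loopPoly p) := by
    nth_rewrite 2 3 [← aeval_X (R := K) S.ε]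
    rw [← map_mul, ← map_mul, mul_comm]
  rw [← S.e_mul_ε, ← mul_assoc, S.z_mul_e_zero, S.e_mul_ε, h, ← S.e_zero_mul_z, ← mul_assoc,
    S.ε_mul_e]

theorem commute_z (x : A) : Commute S.z x := by
  let N : Submodule K A := LinearMap.eqLocus (LinearMap.mulLeft K S.z) (LinearMap.mulRight K S.z)
  have hN : N = ⊤ := by
    have hmul {x y : A} (hx : x ∈ N) (hy : S.z * y = y * S.z) : x * y ∈ N := by
      have hx : S.z * x = x * S.z := hx
      change S.z * (x * y) = x * y * S.z
      rw [← mul_assoc, hx, mul_assoc, hy, mul_assoc]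
    apply S.generate
    · intro i
      exact (S.z_mul_e i).trans (S.e_mul_z i).symm
    · exact fun x hx i => hmul hx (S.z_mul_a i)
    · exact fun x hx i => hmul hx (S.z_mul_b i)
    · exact fun x hx => hmul hx S.z_mul_ε
  have : x ∈ N := hN ▸ Submodule.mem_top
  exact this

theorem z_pow_mul (k : ℕ) (x : A) : S.z ^ k * x = x * S.z ^ k := (S.commute_z x).pow_left k

theorem z_pow_left_comm (k : ℕ) (x y : A) : x * (S.z ^ k * y) = S.z ^ k * (x * y) := by
  rw [← mul_assoc, ← S.z_pow_mul, mul_assoc]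

theorem z_left_comm (x y : A) : x * (S.z * y) = S.z * (x * y) := by
  simpa using S.z_pow_left_comm 1 x y

/-- `z ^ k * e i` factors through the vertex `i + k`. -/
theorem z_pow_mul_e_eq_zero (k i : ℕ) (h : n ≤ i + k) : S.z ^ k * S.e i = 0 := by
  induction k generalizing i with
  | zero => simp [S.e_eq_zero i h]
  | succ k ih =>
    rw [pow_succ, mul_assoc, S.z_mul_e, ← S.a_mul_e, mul_assoc, ← S.z_pow_left_comm,
      ← mul_assoc (S.z ^ k), ih (i + 1) (by omega), zero_mul, mul_zero]

theorem z_pow_mul_eq_zero {i j k : ℕ} {x : A} (hi : S.e i * x = x) (hj : x * S.e j = x)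
    (h : n ≤ max i j + k) : S.z ^ k * x = 0 := by
  rcases le_total i j with hij | hij
  · rw [← hj, ← S.z_pow_left_comm, S.z_pow_mul_e_eq_zero k j (by rwa [max_eq_right hij] at h),
      mul_zero]
  · rw [← hi, ← mul_assoc, S.z_pow_mul_e_eq_zero k i (by rwa [max_eq_left hij] at h), zero_mul]

/-! ### Standard paths -/

/-- The path `a i * a (i + 1) * ⋯ * a (i + k - 1)` from `i` to `i + k`. -/
def up (i : ℕ) : ℕ → A
  | 0 => S.e i
  | k + 1 => up i k * S.a (i + k)

/-- The path `b (i + k - 1) * ⋯ * b (i + 1) * b i` from `i + k` to `i`. -/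
def down (i : ℕ) : ℕ → A
  | 0 => S.e i
  | k + 1 => S.b (i + k) * down i k

theorem e_mul_up (i k : ℕ) : S.e i * S.up i k = S.up i k := by
  induction k with
  | zero => exact S.e_mul_self i
  | succ k ih => rw [up, ← mul_assoc, ih]

theorem up_mul_e (i k : ℕ) : S.up i k * S.e (i + k) = S.up i k := by
  cases k with
  | zero => exact S.e_mul_self i
  | succ k => rw [up, mul_assoc, ← add_assoc, S.a_mul_e]

theorem down_mul_e (i k : ℕ) : S.down i k * S.e i = S.down i k := by
  induction k with
  | zero => exact S.e_mul_self i
  | succ k ih => rw [down, mul_assoc, ih]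

theorem e_mul_down (i k : ℕ) : S.e (i + k) * S.down i k = S.down i k := by
  cases k with
  | zero => exact S.e_mul_self i
  | succ k => rw [down, ← mul_assoc, ← add_assoc, S.e_mul_b]

theorem up_succ_mul_b (i k : ℕ) : S.up i (k + 1) * S.b (i + k) = S.z * S.up i k := by
  rw [up, mul_assoc, ← S.z_mul_e, S.z_left_comm, S.up_mul_e]

theorem down_mul_b (i k : ℕ) : S.down (i + 1) k * S.b i = S.down i (k + 1) := by
  induction k with
  | zero => simp only [down, S.e_mul_b, add_zero, S.b_mul_e]
  | succ k ih => rw [down, mul_assoc, ih, down, down, show i + 1 + k = i + (k + 1) by omega]; rfl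

theorem down_succ_mul_a (i k : ℕ) : S.down i (k + 1) * S.a i = S.z * S.down (i + 1) k := by
  induction k with
  | zero => simp only [down, add_zero, S.b_mul_e, ← S.mesh, S.z_mul_e]
  | succ k ih =>
    rw [down, mul_assoc, ih, S.z_left_comm, down, show i + 1 + k = i + (k + 1) by omega]

theorem up_mul_down (i l k : ℕ) :
    S.up i (l + k) * S.down (i + l) k = S.z ^ k * S.up i l := by
  induction k with
  | zero => simp [down, S.up_mul_e]
  | succ k ih =>
    rw [← add_assoc, down, ← mul_assoc, show i + l + k = i + (l + k) by omega, S.up_succ_mul_b,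
      mul_assoc, ih, pow_succ', mul_assoc]

theorem up_mul_down' (i l k : ℕ) :
    S.up (i + l) k * S.down i (l + k) = S.z ^ k * S.down i l := by
  induction k with
  | zero => simp [up, S.e_mul_down]
  | succ k ih =>
    rw [← add_assoc, down, ← mul_assoc, show i + (l + k) = i + l + k by omega, S.up_succ_mul_b,
      mul_assoc, ih, pow_succ', mul_assoc]

/-- The shortest path from `i` to `j`. -/
def w (i j : ℕ) : A := if i ≤ j then S.up i (j - i) else S.down j (i - j)

/-- The path from `i` down to `0`, once around the loop, and up to `j`. -/
def v (i j : ℕ) : A := S.down 0 i * S.ε * S.up 0 j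

theorem w_add_right (i k : ℕ) : S.w i (i + k) = S.up i k := by
  simp [w]

theorem w_add_left (i k : ℕ) : S.w (i + k) i = S.down i k := by
  cases k with
  | zero => simp [w, up, down]
  | succ k => simp [w]

theorem e_mul_w (i j : ℕ) : S.e i * S.w i j = S.w i j := by
  rcases le_total i j with h | h <;> obtain ⟨k, rfl⟩ := Nat.exists_eq_add_of_le h
  · rw [S.w_add_right, S.e_mul_up]
  · rw [S.w_add_left, S.e_mul_down]

theorem w_mul_e (i j : ℕ) : S.w i j * S.e j = S.w i j := by
  rcases le_total i j with h | h <;> obtain ⟨k, rfl⟩ := Nat.exists_eq_add_of_le h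
  · rw [S.w_add_right, S.up_mul_e]
  · rw [S.w_add_left, S.down_mul_e]

theorem e_mul_v (i j : ℕ) : S.e i * S.v i j = S.v i j := by
  have := S.e_mul_down 0 i
  rw [zero_add] at this
  rw [v, ← mul_assoc, ← mul_assoc, this]

theorem v_mul_e (i j : ℕ) : S.v i j * S.e j = S.v i j := by
  have := S.up_mul_e 0 j
  rw [zero_add] at this
  rw [v, mul_assoc, this]

/-- A path from `0` to `0` without the loop that turns at `j` and `i` is a power of the central
element, with exponent the highest vertex that is reached. -/
theorem up_mul_w_mul_down (i j : ℕ) :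
    S.up 0 j * S.w j i * S.down 0 i = S.z ^ max i j * S.e 0 := by
  have h0 (i : ℕ) : S.up 0 i * S.down 0 i = S.z ^ i * S.e 0 := by
    simpa [up] using S.up_mul_down 0 0 i
  rcases le_total i j with h | h <;> obtain ⟨k, rfl⟩ := Nat.exists_eq_add_of_le h
  · have h1 := S.up_mul_down 0 i k
    rw [zero_add] at h1
    rw [S.w_add_left, h1, mul_assoc, h0, ← mul_assoc, ← pow_add, max_eq_right h, add_comm]
  · have h1 := S.up_mul_down' 0 j k
    rw [zero_add] at h1
    rw [S.w_add_right, mul_assoc, h1, S.z_pow_left_comm, h0, ← mul_assoc, ← pow_add,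
      max_eq_left h, add_comm]

/-! ### The spanning set -/

/-- The span of the elements `z ^ k * w i j` and `z ^ k * v i j`. -/
def pathSpan : Submodule K A :=
  Submodule.span K (Set.range (fun t : ℕ × ℕ × ℕ => S.z ^ t.1 * S.w t.2.1 t.2.2) ∪
    Set.range (fun t : ℕ × ℕ × ℕ => S.z ^ t.1 * S.v t.2.1 t.2.2))

theorem w_mem (k i j : ℕ) : S.z ^ k * S.w i j ∈ S.pathSpan :=
  Submodule.subset_span (Or.inl ⟨(k, i, j), rfl⟩)

theorem v_mem (k i j : ℕ) : S.z ^ k * S.v i j ∈ S.pathSpan :=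
  Submodule.subset_span (Or.inr ⟨(k, i, j), rfl⟩)

theorem up_mem (k i j : ℕ) : S.z ^ k * S.up i j ∈ S.pathSpan := by
  simpa only [w_add_right] using S.w_mem k i (i + j)

theorem down_mem (k i j : ℕ) : S.z ^ k * S.down i j ∈ S.pathSpan := by
  simpa only [w_add_left] using S.w_mem k (i + j) i

theorem mul_mem_pathSpan {y : A} (hw : ∀ k i j, S.z ^ k * (S.w i j * y) ∈ S.pathSpan)
    (hv : ∀ k i j, S.z ^ k * (S.v i j * y) ∈ S.pathSpan) {x : A} (hx : x ∈ S.pathSpan) :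
    x * y ∈ S.pathSpan := by
  induction hx using Submodule.span_induction with
  | mem x h =>
    rcases h with ⟨⟨k, i, j⟩, rfl⟩ | ⟨⟨k, i, j⟩, rfl⟩
    · simpa only [mul_assoc] using hw k i j
    · simpa only [mul_assoc] using hv k i j
  | zero => simp
  | add x x' _ _ h h' => rw [add_mul]; exact Submodule.add_mem _ h h'
  | smul c x _ h => rw [smul_mul_assoc]; exact Submodule.smul_mem _ c h

theorem mul_a_mem {x : A} (hx : x ∈ S.pathSpan) (l : ℕ) : x * S.a l ∈ S.pathSpan := by
  refine S.mul_mem_pathSpan (fun k i j => ?_) (fun k i j => ?_) hx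
  · by_cases hj : j = l
    · subst hj
      rcases le_or_gt i j with h | h
      · obtain ⟨d, rfl⟩ := Nat.exists_eq_add_of_le h
        rw [S.w_add_right]
        exact S.up_mem k i (d + 1)
      · obtain ⟨d, rfl⟩ := Nat.exists_eq_add_of_lt h
        rw [add_assoc, S.w_add_left, S.down_succ_mul_a, ← mul_assoc, ← pow_succ]
        exact S.down_mem _ _ _
    · rw [S.mul_eq_zero_of_ne (S.w_mul_e i j) (S.e_mul_a l) hj, mul_zero]
      exact Submodule.zero_mem _
  · by_cases hj : j = l
    · subst hj
      have : S.v i j * S.a j = S.v i (j + 1) := by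
        rw [v, v, up, zero_add, mul_assoc]
      rw [this]
      exact S.v_mem _ _ _
    · rw [S.mul_eq_zero_of_ne (S.v_mul_e i j) (S.e_mul_a l) hj, mul_zero]
      exact Submodule.zero_mem _

theorem mul_b_mem {x : A} (hx : x ∈ S.pathSpan) (l : ℕ) : x * S.b l ∈ S.pathSpan := by
  refine S.mul_mem_pathSpan (fun k i j => ?_) (fun k i j => ?_) hx
  · by_cases hj : j = l + 1
    · subst hj
      rcases lt_or_ge i (l + 1) with h | h
      · obtain ⟨d, rfl⟩ := Nat.exists_eq_add_of_le (Nat.lt_succ_iff.1 h)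
        rw [add_assoc, S.w_add_right, S.up_succ_mul_b, ← mul_assoc, ← pow_succ]
        exact S.up_mem _ _ _
      · obtain ⟨d, rfl⟩ := Nat.exists_eq_add_of_le h
        rw [S.w_add_left, S.down_mul_b]
        exact S.down_mem _ _ _
    · rw [S.mul_eq_zero_of_ne (S.w_mul_e i j) (S.e_mul_b l) hj, mul_zero]
      exact Submodule.zero_mem _
  · by_cases hj : j = l + 1
    · subst hj
      have h := S.up_succ_mul_b 0 l
      rw [zero_add] at h
      have : S.v i (l + 1) * S.b l = S.z * S.v i l := by
        rw [v, v, mul_assoc, h, S.z_left_comm]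
      rw [this, ← mul_assoc, ← pow_succ]
      exact S.v_mem _ _ _
    · rw [S.mul_eq_zero_of_ne (S.v_mul_e i j) (S.e_mul_b l) hj, mul_zero]
      exact Submodule.zero_mem _

theorem down_mul_aeval_loopPoly_pow (i r : ℕ) :
    S.down 0 i * aeval S.ε (loopPoly p) ^ r = S.z ^ r * S.down 0 i := by
  induction r with
  | zero => simp
  | succ r ih =>
    rw [pow_succ, ← mul_assoc, ih, ← S.e_zero_mul_z, mul_assoc, ← mul_assoc (S.down 0 i),
      S.down_mul_e, ← S.commute_z, ← mul_assoc, pow_succ]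

/-- Powers of the loop can be reduced to `1` and `ε` with coefficients in the powers of `z`. -/
theorem down_mul_aeval_mem (i k : ℕ) (q : K[X]) :
    S.z ^ k * (S.down 0 i * aeval S.ε q) ∈ S.pathSpan := by
  refine mem_of_loopPoly_pow_mem p n (S.pathSpan.comap ((LinearMap.mulLeft K (S.z ^ k)) ∘ₗ
    (LinearMap.mulLeft K (S.down 0 i)) ∘ₗ (aeval S.ε).toLinearMap)) (fun r => ?_) (fun r => ?_)
    (fun h => ?_) q
  · simp only [Submodule.mem_comap, LinearMap.comp_apply, LinearMap.mulLeft_apply,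
      AlgHom.toLinearMap_apply, map_pow, down_mul_aeval_loopPoly_pow]
    rw [← mul_assoc, ← pow_add]
    exact S.down_mem _ _ _
  · simp only [Submodule.mem_comap, LinearMap.comp_apply, LinearMap.mulLeft_apply,
      AlgHom.toLinearMap_apply, map_pow, map_mul, aeval_X]
    rw [← mul_assoc (S.down 0 i), S.down_mul_aeval_loopPoly_pow]
    have : S.down 0 i * S.ε = S.v i 0 := by rw [v, up, mul_assoc, S.ε_mul_e]
    rw [mul_assoc, this, ← mul_assoc, ← pow_add]
    exact S.v_mem _ _ _
  · simp [S.nilpotent]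

theorem mul_ε_mem {x : A} (hx : x ∈ S.pathSpan) : x * S.ε ∈ S.pathSpan := by
  refine S.mul_mem_pathSpan (fun k i j => ?_) (fun k i j => ?_) hx
  · by_cases hj : j = 0
    · subst hj
      have : S.w i 0 = S.down 0 i := by simpa using S.w_add_left 0 i
      simpa [this] using S.down_mul_aeval_mem i k X
    · rw [S.mul_eq_zero_of_ne (S.w_mul_e i j) S.e_mul_ε hj, mul_zero]
      exact Submodule.zero_mem _
  · by_cases hj : j = 0
    · subst hj
      have : S.v i 0 * S.ε = S.down 0 i * aeval S.ε (X ^ 2 : K[X]) := by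
        rw [v, up, mul_assoc, S.e_mul_ε, map_pow, aeval_X, mul_assoc, sq]
      rw [this]
      exact S.down_mul_aeval_mem i k _
    · rw [S.mul_eq_zero_of_ne (S.v_mul_e i j) S.e_mul_ε hj, mul_zero]
      exact Submodule.zero_mem _

theorem pathSpan_eq_top : S.pathSpan = ⊤ := by
  refine S.generate _ (fun i => ?_) (fun x hx i => S.mul_a_mem hx i)
    (fun x hx i => S.mul_b_mem hx i) (fun x hx => S.mul_ε_mem hx)
  simpa [up] using S.up_mem 0 i 0

include S in
theorem finiteDimensional : FiniteDimensional K A := by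
  have hfin (x : ℕ → ℕ → A) (he : ∀ i j, S.e i * x i j = x i j)
      (he' : ∀ i j, x i j * S.e j = x i j) :
      (Set.range (fun t : ℕ × ℕ × ℕ => S.z ^ t.1 * x t.2.1 t.2.2)).Finite := by
    refine (((Set.finite_Iio n).prod ((Set.finite_Iio n).prod (Set.finite_Iio n))).image
      (fun t : ℕ × ℕ × ℕ => S.z ^ t.1 * x t.2.1 t.2.2) |>.union (Set.finite_singleton 0)).subset ?_
    rintro _ ⟨⟨k, i, j⟩, rfl⟩
    by_cases h : n ≤ max i j + k
    · exact Or.inr (S.z_pow_mul_eq_zero (he i j) (he' i j) h)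
    · refine Or.inl ⟨(k, i, j), ?_, rfl⟩
      simp only [Set.mem_prod, Set.mem_Iio]
      omega
  refine ⟨Submodule.fg_def.2 ⟨_, ?_, S.pathSpan_eq_top⟩⟩
  exact (hfin _ S.e_mul_w S.w_mul_e).union (hfin _ S.e_mul_v S.v_mul_e)

/-- The Peirce component `e i * A * e j` is generated over the polynomials in `z` by `w i j` and
`v i j`. -/
theorem exists_normalForm (x : A) (i j : ℕ) : ∃ f g : K[X],
    S.e i * x * S.e j = aeval S.z f * S.w i j + aeval S.z g * S.v i j := by
  have hx : x ∈ S.pathSpan := S.pathSpan_eq_top ▸ Submodule.mem_top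
  have hpath {y : A} {k i' j' : ℕ} (h : S.e i' * y = y) (h' : y * S.e j' = y) :
      S.e i * (S.z ^ k * y) * S.e j = if i = i' ∧ j = j' then S.z ^ k * y else 0 := by
    rw [S.z_pow_left_comm]
    split_ifs with hij
    · rw [hij.1, hij.2, h, mul_assoc, h']
    · by_cases hi : i = i'
      · rw [mul_assoc, mul_assoc,
          S.mul_eq_zero_of_ne h' (S.e_mul_self j) (fun hj => hij ⟨hi, hj.symm⟩), mul_zero, mul_zero]
      · rw [S.mul_eq_zero_of_ne (S.e_mul_self i) h hi, mul_zero, zero_mul]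
  induction hx using Submodule.span_induction with
  | mem x h =>
    rcases h with ⟨⟨k, i', j'⟩, rfl⟩ | ⟨⟨k, i', j'⟩, rfl⟩
    · simp only [hpath (S.e_mul_w i' j') (S.w_mul_e i' j')]
      split_ifs with hij
      · exact ⟨X ^ k, 0, by simp [hij.1, hij.2]⟩
      · exact ⟨0, 0, by simp⟩
    · simp only [hpath (S.e_mul_v i' j') (S.v_mul_e i' j')]
      split_ifs with hij
      · exact ⟨0, X ^ k, by simp [hij.1, hij.2]⟩
      · exact ⟨0, 0, by simp⟩
  | zero => exact ⟨0, 0, by simp⟩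
  | add x x' _ _ h h' =>
    obtain ⟨f, g, h⟩ := h
    obtain ⟨f', g', h'⟩ := h'
    exact ⟨f + f', g + g', by
      rw [mul_add, add_mul, h, h', map_add, map_add, add_mul, add_mul]
      abel⟩
  | smul c x _ h =>
    obtain ⟨f, g, h⟩ := h
    exact ⟨c • f, c • g, by
      rw [mul_smul_comm, smul_mul_assoc, h, map_smul, map_smul, smul_add, smul_mul_assoc,
        smul_mul_assoc]⟩

/-! ### Nondegeneracy of trace forms -/

section Trace

variable {τ : A →ₗ[K] K} (hτ : ∀ x y, τ (x * y) = τ (y * x)) (he : ∀ i, τ (S.e i) = 0)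
include hτ

include he in
/-- Rotating `z ^ (k + 1) * e i = z ^ k * a i * b i` moves it to the vertex `i + 1`, and thus
eventually out of the quiver. -/
theorem trace_z_pow_mul_e (k i : ℕ) : τ (S.z ^ k * S.e i) = 0 := by
  cases k with
  | zero => simpa using he i
  | succ k =>
    have hstep (i : ℕ) : τ (S.z ^ (k + 1) * S.e i) = τ (S.z ^ (k + 1) * S.e (i + 1)) := by
      rw [pow_succ, mul_assoc, S.z_mul_e, ← mul_assoc, hτ, S.z_pow_left_comm, ← S.mesh, mul_assoc,
        S.z_mul_e]
    have (d : ℕ) : τ (S.z ^ (k + 1) * S.e i) = τ (S.z ^ (k + 1) * S.e (i + d)) := by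
      induction d with
      | zero => rfl
      | succ d ih => rw [ih, hstep]; rfl
    rw [this n, S.e_eq_zero _ (by omega), mul_zero, map_zero]

include he in
theorem trace_w_mul_w (k i j : ℕ) : τ (S.z ^ k * (S.w i j * S.w j i)) = 0 := by
  have h (k i d : ℕ) : τ (S.z ^ k * (S.up i d * S.down i d)) = 0 := by
    have := S.up_mul_down i 0 d
    rw [zero_add, add_zero] at this
    rw [this, up, ← mul_assoc, ← pow_add]
    exact S.trace_z_pow_mul_e hτ he _ _
  rcases le_total i j with hij | hij <;> obtain ⟨d, rfl⟩ := Nat.exists_eq_add_of_le hij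
  · rw [S.w_add_left, S.w_add_right, h]
  · rw [S.w_add_left, S.w_add_right, ← mul_assoc, hτ, S.z_pow_left_comm, h]

theorem trace_v_mul_w (k i j : ℕ) :
    τ (S.z ^ k * (S.v i j * S.w j i)) = τ (S.z ^ (k + max i j) * S.ε) := by
  have : S.ε * (S.up 0 j * S.w j i * S.down 0 i) = S.z ^ max i j * S.ε := by
    rw [S.up_mul_w_mul_down, S.z_pow_left_comm, S.ε_mul_e]
  rw [v, mul_assoc, mul_assoc, ← mul_assoc, hτ, S.z_pow_left_comm, mul_assoc, this, ← mul_assoc,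
    pow_add]

theorem trace_w_mul_v (k i j : ℕ) :
    τ (S.z ^ k * (S.w i j * S.v j i)) = τ (S.z ^ (k + max i j) * S.ε) := by
  rw [← mul_assoc, hτ, S.z_pow_left_comm, S.trace_v_mul_w hτ, max_comm]

omit hτ in
theorem z_pow_mul_ε (k : ℕ) :
    S.z ^ k * S.ε = S.ε ^ (2 * k + 1) * aeval S.ε (1 + X * p) ^ k := by
  have h := S.down_mul_aeval_loopPoly_pow 0 k
  rw [down, ← map_pow] at h
  have hc : aeval S.ε (loopPoly p ^ k) * S.ε = S.ε * aeval S.ε (loopPoly p ^ k) := by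
    nth_rewrite 2 3 [← aeval_X (R := K) S.ε]
    rw [← map_mul, ← map_mul, mul_comm]
  have : S.z ^ k * S.ε = aeval S.ε (loopPoly p ^ k * X) := by
    rw [← S.e_mul_ε, ← mul_assoc, ← h, mul_assoc, hc, ← mul_assoc, S.e_mul_ε, ← hc, map_mul,
      aeval_X]
  rw [this, loopPoly_pow, mul_right_comm, ← pow_succ, map_mul, map_pow, map_pow, aeval_X]


include he in
/-- A trace form that vanishes on the idempotents at the vertices and not on `ε ^ (2 * n - 1)`
is nondegenerate. -/
theorem trace_nondegenerate (hε : τ (S.ε ^ (2 * n - 1)) ≠ 0) (x : A)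
    (hx : ∀ y, τ (x * y) = 0) : x = 0 := by
  -- it suffices to treat each Peirce component of `x`
  suffices h : ∀ i j, S.e i * x * S.e j = 0 by
    calc x = (∑ i ∈ Finset.range n, S.e i) * x * ∑ j ∈ Finset.range n, S.e j := by
          rw [S.sum_e, one_mul, mul_one]
      _ = 0 := by simp only [Finset.sum_mul, Finset.mul_sum, h, Finset.sum_const_zero]
  intro i j
  have hx' (y : A) : τ (S.e i * x * S.e j * y) = 0 := by
    rw [mul_assoc, mul_assoc, hτ, mul_assoc, hx]
  rcases le_or_gt n (max i j) with hij | hij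
  · have : S.z ^ 0 * (S.e i * x * S.e j) = 0 := by
      refine S.z_pow_mul_eq_zero (i := i) (j := j) ?_ ?_ hij
      · rw [← mul_assoc, ← mul_assoc, S.e_mul_self]
      · rw [mul_assoc, S.e_mul_self]
    simpa using this
  have hn : n - 1 + 1 - max i j = n - max i j := by omega
  have hs : τ (S.z ^ (n - 1) * S.ε) ≠ 0 := by
    obtain ⟨q, hq⟩ := sub_dvd_pow_sub_pow (1 + X * p) 1 (n - 1)
    have hq : (1 + X * p) ^ (n - 1) = 1 + X * (p * q) := by linear_combination hq
    rw [S.z_pow_mul_ε, ← map_pow, hq, map_add (aeval S.ε), map_one, map_mul (aeval S.ε), aeval_X,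
      mul_add, ← mul_assoc, ← pow_succ, show 2 * (n - 1) + 1 + 1 = 2 * n by omega, S.nilpotent,
      zero_mul, mul_one,
      add_zero, show 2 * (n - 1) + 1 = 2 * n - 1 by omega]
    exact hε
  have hs' (q : ℕ) (hq : n - 1 < q) : τ (S.z ^ q * S.ε) = 0 := by
    have : S.z ^ q * S.ε = 0 :=
      S.z_pow_mul_eq_zero S.e_mul_ε S.ε_mul_e (by omega)
    rw [this, map_zero]
  have hdvd {g : K[X]} (hg : X ^ (n - max i j) ∣ g) {y : A} (h : S.e i * y = y)
      (h' : y * S.e j = y) : aeval S.z g * y = 0 := by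
    obtain ⟨g, rfl⟩ := hg
    rw [mul_comm, map_mul, map_pow, aeval_X, mul_assoc,
      S.z_pow_mul_eq_zero h h' (by omega), mul_zero]
  have hsum (f : K[X]) (k : ℕ) (y y' : A) : τ (aeval S.z f * y * (S.z ^ k * y')) =
      ∑ r ∈ Finset.range (f.natDegree + 1), f.coeff r * τ (S.z ^ (r + k) * (y * y')) := by
    rw [aeval_eq_sum_range, Finset.sum_mul, Finset.sum_mul, map_sum]
    refine Finset.sum_congr rfl fun r _ => ?_
    rw [smul_mul_assoc, smul_mul_assoc, map_smul, smul_eq_mul, mul_assoc, S.z_pow_left_comm,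
      ← mul_assoc, ← pow_add]
  obtain ⟨f, g, hfg⟩ := S.exists_normalForm x i j
  rw [hfg] at hx' ⊢
  have hg : X ^ (n - max i j) ∣ g := by
    rw [← hn]
    refine X_pow_dvd_of_sum_shift_eq_zero (s := fun q => τ (S.z ^ q * S.ε)) (by omega) hs hs' g
      fun k => ?_
    have h := hx' (S.z ^ k * S.w j i)
    rw [add_mul, map_add, hsum, hsum] at h
    simpa only [S.trace_w_mul_w hτ he, S.trace_v_mul_w hτ, mul_zero, Finset.sum_const_zero,
      zero_add] using h
  rw [hdvd hg (S.e_mul_v i j) (S.v_mul_e i j), add_zero] at hx' ⊢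
  refine hdvd ?_ (S.e_mul_w i j) (S.w_mul_e i j)
  rw [← hn]
  refine X_pow_dvd_of_sum_shift_eq_zero (s := fun q => τ (S.z ^ q * S.ε)) (by omega) hs hs' f
    fun k => ?_
  have h := hx' (S.z ^ k * S.v j i)
  rw [hsum] at h
  simpa only [S.trace_w_mul_v hτ] using h

include he in
theorem isSelfDualSymmetricAlgebra (hε : τ (S.ε ^ (2 * n - 1)) ≠ 0) :
    IsSelfDualSymmetricAlgebra K A := by
  have := S.finiteDimensional
  let φ : A →ₗ[K] Module.Dual K A := (LinearMap.mul K A).compr₂ τ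
  have hφ : Function.Injective φ := by
    rw [injective_iff_map_eq_zero]
    exact fun x hx => S.trace_nondegenerate hτ he hε x fun y => LinearMap.congr_fun hx y
  refine ⟨this, φ.linearEquivOfInjective hφ Subspace.dual_finrank_eq.symm, fun b y c x => ?_⟩
  change τ (b * y * c * x) = τ (y * (c * x * b))
  rw [mul_assoc b, mul_assoc b, hτ]
  simp only [mul_assoc]

end Trace
end LSystem

namespace PathAlgebra

/-! ### Generation of the path algebra and weights of paths -/

section General

variable {K V : Type*} [CommRing K] [Quiver V]

theorem of_mul_ofArrow {u v w : V} (q : Quiver.Path u v) (α : v ⟶ w) :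
    (of ⟨u, v, q⟩ * of (QPath.ofArrow α) : PathAlgebra K V) = of ⟨u, w, q.cons α⟩ := by
  simp [of_mul_of, mulPath, QPath.ofArrow, QPath.concat_mk]

theorem trivial_mul_ofArrow {v w : V} (α : v ⟶ w) :
    (of (QPath.trivial v) * of (QPath.ofArrow α) : PathAlgebra K V) = of (QPath.ofArrow α) :=
  of_mul_ofArrow _ α

theorem ofArrow_mul_trivial {v w : V} (α : v ⟶ w) :
    (of (QPath.ofArrow α) * of (QPath.trivial w) : PathAlgebra K V) = of (QPath.ofArrow α) := by
  simp [of_mul_of, mulPath, QPath.ofArrow, QPath.trivial, QPath.concat_mk]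

theorem trivial_mul_trivial_self (v : V) :
    (of (QPath.trivial v) * of (QPath.trivial v) : PathAlgebra K V) = of (QPath.trivial v) := by
  simp [of_mul_of, mulPath, QPath.trivial, QPath.concat_mk]

theorem trivial_mul_trivial_of_ne {v w : V} (h : v ≠ w) :
    (of (QPath.trivial v) * of (QPath.trivial w) : PathAlgebra K V) = 0 := by
  rw [of_mul_of, mulPath, QPath.concat_of_ne (by exact h), Option.elim_none]

theorem eq_top_of_mul_arrow_mem (N : Submodule K (PathAlgebra K V))
    (h₀ : ∀ v, of (QPath.trivial v) ∈ N)
    (h₁ : ∀ x ∈ N, ∀ (v w : V) (α : v ⟶ w), x * of (QPath.ofArrow α) ∈ N) : N = ⊤ := by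
  refine Submodule.eq_top_iff'.2 fun x => ?_
  induction x using induction_on with
  | zero => exact N.zero_mem
  | add x y hx hy => exact N.add_mem hx hy
  | smul_of c q =>
    refine N.smul_mem c ?_
    obtain ⟨u, v, q⟩ := q
    induction q with
    | nil => exact h₀ u
    | cons q α ih =>
      rw [← of_mul_ofArrow]
      exact h₁ _ ih _ _ α

variable {R : Type*} [CommRing R] [Algebra K R] (wt : ∀ {v w : V}, (v ⟶ w) → R)

open Classical in
/-- The linear map that sends a path from `u` to `v` to the matrix whose only nonzero entry is the
weight of the path, at the place `(u, v)`. -/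
noncomputable def weightMatrixLinear : PathAlgebra K V →ₗ[K] Matrix V V R :=
  Finsupp.linearCombination K fun q : QPath V => Matrix.single q.src q.tgt (q.path.weight wt)

open Classical in
theorem weightMatrixLinear_of (q : QPath V) :
    weightMatrixLinear (K := K) wt (of q) = Matrix.single q.src q.tgt (q.path.weight wt) :=
  (Finsupp.linearCombination_single K (1 : K) q).trans (one_smul K _)

variable [Fintype V]

open Classical in
/-- The map `weightMatrixLinear` as a homomorphism of algebras. -/
noncomputable def weightMatrix : PathAlgebra K V →ₐ[K] Matrix V V R :=
  AlgHom.ofLinearMap (weightMatrixLinear wt)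
    (by
      rw [one_def, map_sum, ← Matrix.sum_single_one]
      exact Finset.sum_congr rfl fun v _ => by
        rw [weightMatrixLinear_of]; simp [QPath.trivial])
    (by
      intro x y
      induction x using induction_on with
      | zero => simp
      | add x x' hx hx' => rw [add_mul, map_add, map_add, hx, hx', add_mul]
      | smul_of c q =>
        rw [smul_mul_aux, map_smul, map_smul, smul_mul_assoc]
        congr 1
        induction y using induction_on with
        | zero => simp
        | add y y' hy hy' => rw [mul_add, map_add, map_add, hy, hy', mul_add]
        | smul_of d r =>
          rw [mul_smul_aux, map_smul, map_smul, mul_smul_comm]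
          congr 1
          obtain ⟨u, v, q⟩ := q
          obtain ⟨v', w, r⟩ := r
          rw [weightMatrixLinear_of, weightMatrixLinear_of, of_mul_of, mulPath]
          by_cases h : v = v'
          · subst h
            rw [QPath.concat_mk, Option.elim_some, weightMatrixLinear_of,
              Matrix.single_mul_single_same, Quiver.Path.weight_comp]
          · rw [QPath.concat_of_ne h, Option.elim_none, map_zero,
              Matrix.single_mul_single_of_ne _ _ _ _ h])

open Classical in
theorem weightMatrix_of (q : QPath V) :
    weightMatrix (K := K) wt (of q) = Matrix.single q.src q.tgt (q.path.weight wt) :=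
  weightMatrixLinear_of wt q

open Classical in
/-- The linear form on the path algebra that sends a closed path to the value of `t` at its
weight, and all other paths to zero. -/
noncomputable def weightTrace (t : R →ₗ[K] K) : PathAlgebra K V →ₗ[K] K :=
  t ∘ₗ Matrix.traceLinearMap V K R ∘ₗ (weightMatrix wt).toLinearMap

open Classical in
theorem weightTrace_apply (t : R →ₗ[K] K) (x : PathAlgebra K V) :
    weightTrace wt t x = t (weightMatrix wt x).trace := rfl

theorem weightTrace_mul_comm (t : R →ₗ[K] K) (x y : PathAlgebra K V) :
    weightTrace wt t (x * y) = weightTrace wt t (y * x) := by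
  classical
  rw [weightTrace_apply, weightTrace_apply, map_mul, map_mul, Matrix.trace_mul_comm]

end General

end PathAlgebra

/-! ### Trace forms on quotients by relations -/

/-- A trace form that vanishes on the multiples of the defining relations descends to the quotient.
-/
theorem RingQuot.exists_traceForm {K B : Type*} [Field K] [Ring B] [Algebra K B]
    {r : B → B → Prop} (τ : B →ₗ[K] K) (hτ : ∀ x y, τ (x * y) = τ (y * x))
    (hr : ∀ x y, r x y → ∀ u, τ (u * x) = τ (u * y)) :
    ∃ σ : RingQuot r →ₗ[K] K, (∀ x y, σ (x * y) = σ (y * x)) ∧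
      ∀ x, σ (RingQuot.mkAlgHom K r x) = τ x := by
  have hrel : ∀ x y, RingQuot.Rel r x y → ∀ u, τ (u * x) = τ (u * y) := by
    intro x y h
    induction h with
    | of h => exact hr _ _ h
    | add_left _ ih => intro u; rw [mul_add, mul_add, map_add, map_add, ih]
    | mul_left _ ih => intro u; rw [← mul_assoc, hτ, ← mul_assoc, ih, mul_assoc, hτ, mul_assoc]
    | mul_right _ ih => intro u; rw [← mul_assoc, ih, mul_assoc]
  have hmk : ∀ x y, RingQuot.mkAlgHom K r x = RingQuot.mkAlgHom K r y → τ x = τ y := by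
    intro x y h
    have h : RingQuot.mkRingHom r x = RingQuot.mkRingHom r y := by
      rw [← RingQuot.mkAlgHom_coe K]; exact h
    simp only [RingQuot.mkRingHom_def, RingHom.coe_mk, MonoidHom.coe_mk, OneHom.coe_mk,
      RingQuot.mk.injEq] at h
    have h := Quot.eqvGen_exact h
    have : ∀ x y, Relation.EqvGen (RingQuot.Rel r) x y → τ x = τ y := by
      intro x y h
      induction h with
      | rel x y h => simpa using hrel x y h 1
      | refl => rfl
      | symm _ _ _ ih => exact ih.symm
      | trans _ _ _ _ _ ih ih' => exact ih.trans ih'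
    exact this x y h
  have hsurj := RingQuot.mkAlgHom_surjective K r
  let σ : RingQuot r →ₗ[K] K :=
    { toFun := fun x => τ (Function.surjInv hsurj x)
      map_add' := fun x y => by
        rw [← map_add]
        apply hmk
        simp [Function.surjInv_eq]
      map_smul' := fun c x => by
        rw [RingHom.id_apply, ← map_smul]
        apply hmk
        simp [Function.surjInv_eq] }
  have hσ (x : B) : σ (RingQuot.mkAlgHom K r x) = τ x := hmk _ _ (Function.surjInv_eq hsurj _)
  refine ⟨σ, fun x y => ?_, hσ⟩
  obtain ⟨x, rfl⟩ := hsurj x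
  obtain ⟨y, rfl⟩ := hsurj y
  rw [← map_mul, ← map_mul, hσ, hσ, hτ]

namespace DeformedL

variable (K : Type*) [Field K] (n : ℕ) (p : K[X])

/-! ### The generators of `L_n^p` -/

/-- The trivial path at the vertex `i`, as an element of the path algebra; zero for `n ≤ i`. -/
noncomputable def idem (i : ℕ) : PathAlgebra K (LVertex n) :=
  if h : i < n then PathAlgebra.of (QPath.trivial ⟨i, h⟩) else 0

theorem idem_mul_self (i : ℕ) : idem K n i * idem K n i = idem K n i := by
  by_cases h : i < n
  · simp [idem, h, PathAlgebra.trivial_mul_trivial_self]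
  · simp [idem, h]

theorem idem_mul_of_ne {i j : ℕ} (hij : i ≠ j) : idem K n i * idem K n j = 0 := by
  by_cases hi : i < n
  · by_cases hj : j < n
    · simp only [idem, hi, hj, dif_pos]
      exact PathAlgebra.trivial_mul_trivial_of_ne fun h => hij (congrArg LVertex.val h)
    · simp [idem, hj]
  · simp [idem, hi]

theorem sum_idem : ∑ i ∈ Finset.range n, idem K n i = 1 := by
  rw [PathAlgebra.one_def, ← Fin.sum_univ_eq_sum_range]
  let f : Fin n ≃ LVertex n :=
    ⟨fun i => ⟨i.1, i.2⟩, fun v => ⟨v.1, v.2⟩, fun _ => rfl, fun _ => rfl⟩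
  rw [← f.sum_comp]
  exact Finset.sum_congr rfl fun i _ => by simp [idem, f]

theorem idem_mul_a (i : ℕ) : idem K n i * a K n i = a K n i := by
  by_cases h : i + 1 < n
  · simp [idem, a, h, Nat.lt_of_succ_lt h, PathAlgebra.trivial_mul_ofArrow]
  · simp [a, h]

theorem a_mul_idem (i : ℕ) : a K n i * idem K n (i + 1) = a K n i := by
  by_cases h : i + 1 < n
  · simp [idem, a, h, PathAlgebra.ofArrow_mul_trivial]
  · simp [a, h]

theorem idem_mul_abar (i : ℕ) : idem K n (i + 1) * abar K n i = abar K n i := by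
  by_cases h : i + 1 < n
  · simp [idem, abar, h, PathAlgebra.trivial_mul_ofArrow]
  · simp [abar, h]

theorem abar_mul_idem (i : ℕ) : abar K n i * idem K n i = abar K n i := by
  by_cases h : i + 1 < n
  · simp [idem, abar, h, Nat.lt_of_succ_lt h, PathAlgebra.ofArrow_mul_trivial]
  · simp [abar, h]

theorem idem_mul_eps : idem K n 0 * eps K n = eps K n := by
  by_cases h : 0 < n
  · simp [idem, eps, h, PathAlgebra.trivial_mul_ofArrow]
  · simp [eps, h]

theorem eps_mul_idem : eps K n * idem K n 0 = eps K n := by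
  by_cases h : 0 < n
  · simp [idem, eps, h, PathAlgebra.ofArrow_mul_trivial]
  · simp [eps, h]

/-- The generators of the deformed preprojective algebra; the sign of `ā_i` is changed to
`(-1) ^ (i + 1)`. -/
noncomputable def lSystem : LSystem (DeformedPreprojectiveL K n p) n p :=
  let π := RingQuot.mkAlgHom K (Rel K n p)
  { e := fun i => π (idem K n i)
    a := fun i => π (a K n i)
    b := fun i => (-1 : K) ^ (i + 1) • π (abar K n i)
    ε := π (eps K n)
    e_mul_self := fun i => by rw [← map_mul, idem_mul_self]
    e_mul_of_ne := fun i j h => by rw [← map_mul, idem_mul_of_ne K n h, map_zero]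
    e_eq_zero := fun i h => by rw [idem, dif_neg (by omega), map_zero]
    sum_e := by rw [← map_sum, sum_idem, map_one]
    e_mul_a := fun i => by rw [← map_mul, idem_mul_a]
    a_mul_e := fun i => by rw [← map_mul, a_mul_idem]
    e_mul_b := fun i => by rw [mul_smul_comm, ← map_mul, idem_mul_abar]
    b_mul_e := fun i => by rw [smul_mul_assoc, ← map_mul, abar_mul_idem]
    e_mul_ε := by rw [← map_mul, idem_mul_eps]
    ε_mul_e := by rw [← map_mul, eps_mul_idem]
    mesh := fun i => by
      have h : π (a K n (i + 1)) * π (abar K n (i + 1)) = - (π (abar K n i) * π (a K n i)) := by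
        rcases lt_trichotomy (i + 2) n with h | h | h
        · have := RingQuot.mkAlgHom_rel K (Rel.mesh (K := K) (p := p) (i + 1) (by omega) h)
          rw [map_zero, map_add, map_mul, map_mul] at this
          exact eq_neg_of_add_eq_zero_left this
        · have := RingQuot.mkAlgHom_rel K (Rel.last (K := K) (p := p) i h)
          rw [map_zero, map_mul] at this
          rw [this, a, dif_neg (by omega), map_zero, zero_mul, neg_zero]
        · rw [a, a, dif_neg (by omega), dif_neg (by omega)]
          simp
      rw [mul_smul_comm, smul_mul_assoc, h, pow_succ _ (i + 1)]
      simp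
    deformed := by
      have := RingQuot.mkAlgHom_rel K (Rel.deformed (K := K) (n := n) (p := p))
      rw [map_zero] at this
      rw [aeval_algHom_apply, mul_smul_comm, ← map_mul, loopPoly]
      simp only [map_add, map_mul, map_pow, aeval_X] at this ⊢
      rw [zero_add, pow_one, neg_one_smul, neg_eq_iff_add_eq_zero, ← this]
      abel
    nilpotent := by
      have := RingQuot.mkAlgHom_rel K (Rel.nilpotent (K := K) (n := n) (p := p))
      rwa [map_zero, map_pow] at this
    generate := fun N he ha hb hε => by
      have h : N.comap π.toLinearMap = ⊤ := by
        refine PathAlgebra.eq_top_of_mul_arrow_mem _ (fun v => ?_) (fun x hx v w α => ?_)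
        · have := he v.val
          rwa [idem, dif_pos v.lt] at this
        · simp only [Submodule.mem_comap, AlgHom.toLinearMap_apply, map_mul] at hx ⊢
          change LArrow n v w at α
          cases α with
          | eps h =>
            have := hε _ hx
            rwa [eps, dif_pos h] at this
          | a i h =>
            have := ha _ hx i
            rwa [a, dif_pos h] at this
          | abar i h =>
            have := N.smul_mem ((-1) ^ (i + 1)) (hb _ hx i)
            rw [mul_smul_comm, smul_smul, ← mul_pow, neg_one_mul, neg_neg, one_pow, one_smul,
              abar, dif_pos h] at this
            exact this
      refine Submodule.eq_top_iff'.2 fun x => ?_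
      obtain ⟨x, rfl⟩ := RingQuot.mkAlgHom_surjective K _ x
      have : x ∈ N.comap π.toLinearMap := h ▸ Submodule.mem_top
      exact this }

/-! ### The trace form -/

/-- The weights of the arrows in the polynomial ring: `X` for the loop, `1` for `a_i` and
`(-1) ^ (i + 1) (X² + X³ p)` for `ā_i`. -/
noncomputable def arrowWeight {n : ℕ} : ∀ {v w : LVertex n}, (v ⟶ w) → K[X]
  | _, _, LArrow.eps _ => X
  | _, _, LArrow.a _ _ => 1
  | _, _, LArrow.abar i _ => (-1) ^ (i + 1) * loopPoly p

/-- A path from the last vertex that uses the loop has to pass all arrows `ā_i` before, so its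
weight is divisible by `loopPoly p ^ (n - 1)`; the weight of any other path is a polynomial in
`loopPoly p`. -/
theorem weight_of_src_last {u v : LVertex n} (hu : u.val + 1 = n) (q : Quiver.Path u v) :
    ∃ f h : K[X], q.weight (arrowWeight K p) =
      loopPoly p ^ (u.val - v.val) * aeval (loopPoly p) f + loopPoly p ^ u.val * h := by
  induction q with
  | nil => exact ⟨1, 0, by simp⟩
  | cons q α ih =>
    obtain ⟨f, h, ih⟩ := ih
    rw [Quiver.Path.weight_cons, ih]
    rename_i v w
    change LArrow n v w at α
    cases α with
    | eps h0 => exact ⟨0, (aeval (loopPoly p) f + h) * X, by simp [arrowWeight]; ring⟩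
    | a i hi =>
      refine ⟨X * f, h, ?_⟩
      simp only [arrowWeight]
      rw [map_mul, aeval_X, show u.val - i = u.val - (i + 1) + 1 by omega]
      ring
    | abar i hi =>
      refine ⟨(-1) ^ (i + 1) * f, (-1) ^ (i + 1) * loopPoly p * h, ?_⟩
      simp only [arrowWeight]
      rw [map_mul, map_pow, map_neg, map_one, show u.val - i = u.val - (i + 1) + 1 by omega]
      ring

section Trace

variable {K p}

open Classical in
theorem weightMatrix_a {i : ℕ} (h : i + 1 < n) :
    PathAlgebra.weightMatrix (arrowWeight K p) (a K n i) =
      Matrix.single ⟨i, Nat.lt_of_succ_lt h⟩ ⟨i + 1, h⟩ 1 := by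
  rw [a, dif_pos h, PathAlgebra.weightMatrix_of]
  simp [QPath.ofArrow, Quiver.Hom.toPath, arrowWeight]

open Classical in
theorem weightMatrix_abar {i : ℕ} (h : i + 1 < n) :
    PathAlgebra.weightMatrix (arrowWeight K p) (abar K n i) =
      Matrix.single ⟨i + 1, h⟩ ⟨i, Nat.lt_of_succ_lt h⟩ ((-1) ^ (i + 1) * loopPoly p) := by
  rw [abar, dif_pos h, PathAlgebra.weightMatrix_of]
  simp [QPath.ofArrow, Quiver.Hom.toPath, arrowWeight]

open Classical in
theorem weightMatrix_aeval_eps (h : 0 < n) (q : K[X]) :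
    PathAlgebra.weightMatrix (arrowWeight K p) (aeval (eps K n) (X * q)) =
      Matrix.single ⟨0, h⟩ ⟨0, h⟩ (X * q) := by
  have heps : PathAlgebra.weightMatrix (arrowWeight K p) (eps K n) =
      Matrix.single ⟨0, h⟩ ⟨0, h⟩ X := by
    rw [eps, dif_pos h, PathAlgebra.weightMatrix_of]
    simp [QPath.ofArrow, Quiver.Hom.toPath, arrowWeight]
  rw [← aeval_algHom_apply, heps, map_mul, aeval_X]
  induction q using Polynomial.induction_on' with
  | add q r hq hr => rw [map_add, mul_add, hq, hr, mul_add, Matrix.single_add]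
  | monomial k c =>
    have hpow (k : ℕ) : (Matrix.single ⟨0, h⟩ ⟨0, h⟩ X : Matrix (LVertex n) (LVertex n) K[X]) *
        Matrix.single ⟨0, h⟩ ⟨0, h⟩ X ^ k = Matrix.single ⟨0, h⟩ ⟨0, h⟩ (X * X ^ k) := by
      induction k with
      | zero => simp
      | succ k ih => rw [pow_succ, ← mul_assoc, ih, Matrix.single_mul_single_same, mul_assoc,
          ← pow_succ]
    rw [← smul_X_eq_monomial, map_smul, map_pow, aeval_X, mul_smul_comm, hpow, mul_smul_comm,
      Matrix.smul_single]

/-- If the weight matrix of `x` has its only entry at `(i, i)`, then the trace form on the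
multiples of `x` is determined by the closed paths at `i`. -/
theorem weightTrace_mul_of_single {i : LVertex n} {c : K[X]} {x : PathAlgebra K (LVertex n)}
    (t : K[X] →ₗ[K] K)
    (hx : by classical exact PathAlgebra.weightMatrix (arrowWeight K p) x = Matrix.single i i c)
    (hc : ∀ q : Quiver.Path i i, t (q.weight (arrowWeight K p) * c) = 0)
    (u : PathAlgebra K (LVertex n)) :
    PathAlgebra.weightTrace (arrowWeight K p) t (u * x) = 0 := by
  classical
  induction u using PathAlgebra.induction_on with
  | zero => simp
  | add u u' hu hu' => rw [add_mul, map_add, hu, hu', add_zero]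
  | smul_of d q =>
    rw [PathAlgebra.smul_mul_aux, map_smul, PathAlgebra.weightTrace_apply, map_mul, hx,
      PathAlgebra.weightMatrix_of]
    obtain ⟨v, w, q⟩ := q
    by_cases hw : w = i
    · subst hw
      rw [Matrix.single_mul_single_same]
      by_cases hv : v = w
      · subst hv
        rw [Matrix.trace_single_eq_same, hc, smul_zero]
      · rw [Matrix.trace_single_eq_of_ne _ _ _ hv, map_zero, smul_zero]
    · rw [Matrix.single_mul_single_of_ne _ _ _ _ hw, Matrix.trace_zero, map_zero, smul_zero]

/-- The trace form vanishes on the multiples of the defining relations. -/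
theorem weightTrace_mul_rel {t : K[X] →ₗ[K] K} (ht : ∀ h, t (X ^ (2 * n) * h) = 0)
    (ht' : ∀ F : K[X], t (aeval (loopPoly p) F) = 0) (x y : PathAlgebra K (LVertex n))
    (h : Rel K n p x y) (u : PathAlgebra K (LVertex n)) :
    PathAlgebra.weightTrace (arrowWeight K p) t (u * x) =
      PathAlgebra.weightTrace (arrowWeight K p) t (u * y) := by
  classical
  have hzero {x : PathAlgebra K (LVertex n)}
      (hx : PathAlgebra.weightMatrix (arrowWeight K p) x = 0) :
      PathAlgebra.weightTrace (arrowWeight K p) t (u * x) = 0 := by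
    rw [PathAlgebra.weightTrace_apply, map_mul, hx, mul_zero, Matrix.trace_zero, map_zero]
  cases h with
  | mesh s h₁ h₂ =>
    obtain ⟨s, rfl⟩ := Nat.exists_eq_add_of_le' h₁
    rw [mul_zero, map_zero]
    apply hzero
    rw [map_add, map_mul, map_mul, Nat.add_sub_cancel, weightMatrix_a n (by omega),
      weightMatrix_a n (by omega), weightMatrix_abar n (by omega), weightMatrix_abar n (by omega),
      Matrix.single_mul_single_same, Matrix.single_mul_single_same, ← Matrix.single_add]
    refine (congrArg (Matrix.single _ _) ?_).trans (Matrix.single_zero _ _)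
    ring
  | last s hs =>
    rw [mul_zero, map_zero]
    refine weightTrace_mul_of_single n t (i := ⟨s + 1, by omega⟩)
      (c := (-1) ^ (s + 1) * loopPoly p) ?_ (fun q => ?_) u
    · rw [map_mul, weightMatrix_a n (by omega), weightMatrix_abar n (by omega),
        Matrix.single_mul_single_same, mul_one]
    · obtain ⟨f, h, hq⟩ := weight_of_src_last K n p (by simpa using hs) q
      have : q.weight (arrowWeight K p) * ((-1) ^ (s + 1) * loopPoly p) =
          aeval (loopPoly p) (f * ((-1) ^ (s + 1) * X)) +
            X ^ (2 * n) * ((1 + X * p) ^ n * h * (-1) ^ (s + 1)) := by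
        have hn : loopPoly p ^ (s + 2) = X ^ (2 * n) * (1 + X * p) ^ n := by
          rw [hs, loopPoly_pow]
        rw [hq, map_mul, map_mul, map_pow, map_neg, map_one, aeval_X, Nat.sub_self]
        linear_combination (-1) ^ (s + 1) * h * hn
      rw [this, map_add, ht, ht', add_zero]
  | nilpotent =>
    rw [mul_zero, map_zero]
    rcases Nat.eq_zero_or_pos n with hn | hn
    · subst hn
      apply hzero
      ext i
      exact absurd i.lt (Nat.not_lt_zero _)
    · refine weightTrace_mul_of_single n t (i := ⟨0, hn⟩) (c := X * X ^ (2 * n - 1)) ?_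
        (fun q => ?_) u
      · have h : eps K n ^ (2 * n) = aeval (eps K n) (X * X ^ (2 * n - 1) : K[X]) := by
          rw [← pow_succ', map_pow, aeval_X]
          congr 1
          omega
        rw [h, weightMatrix_aeval_eps n hn]
      · rw [← pow_succ', mul_comm, show 2 * n - 1 + 1 = 2 * n by omega, ht]
  | deformed =>
    rw [mul_zero, map_zero]
    rcases Nat.eq_zero_or_pos n with hn | hn
    · subst hn
      apply hzero
      ext i
      exact absurd i.lt (Nat.not_lt_zero _)
    have heps : eps K n ^ 2 + eps K n ^ 3 * aeval (eps K n) p =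
        aeval (eps K n) (X * (X + X ^ 2 * p)) := by
      simp only [map_mul, map_add, map_pow, aeval_X]
      noncomm_ring
    rw [add_right_comm, heps]
    rcases Nat.lt_or_ge 1 n with hn' | hn'
    · apply hzero
      rw [map_add, weightMatrix_aeval_eps n hn, map_mul, weightMatrix_a n hn',
        weightMatrix_abar n hn', Matrix.single_mul_single_same, ← Matrix.single_add]
      refine (congrArg (Matrix.single _ _) ?_).trans (Matrix.single_zero _ _)
      rw [loopPoly]
      ring
    · -- for `n = 1` the relation has the nonzero weight `X² + X³ p`, a multiple of `X ^ (2 * n)`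
      obtain rfl : n = 1 := by omega
      rw [a, dif_neg (by omega), zero_mul, add_zero]
      refine weightTrace_mul_of_single 1 t (weightMatrix_aeval_eps 1 hn _) (fun q => ?_) u
      rw [← ht (q.weight (arrowWeight K p) * (1 + X * p))]
      congr 1
      ring

variable (K p) in
/-- The trace form of `L_n^p`: the sum of the diagonal weights, composed with the linear form of
`exists_linearForm`. -/
theorem exists_traceForm (hn : 1 ≤ n) : ∃ τ : DeformedPreprojectiveL K n p →ₗ[K] K,
    (∀ x y, τ (x * y) = τ (y * x)) ∧ (∀ i, τ ((lSystem K n p).e i) = 0) ∧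
      τ ((lSystem K n p).ε ^ (2 * n - 1)) ≠ 0 := by
  classical
  obtain ⟨t, ht, ht', hne⟩ := exists_linearForm p hn
  obtain ⟨τ, hτ, hτ'⟩ := RingQuot.exists_traceForm
    (PathAlgebra.weightTrace (arrowWeight K p) t)
    (PathAlgebra.weightTrace_mul_comm _ t) (weightTrace_mul_rel n ht ht')
  refine ⟨τ, hτ, fun i => ?_, ?_⟩
  · refine (hτ' _).trans ?_
    by_cases h : i < n
    · have := ht' 1
      rw [map_one] at this
      rw [idem, dif_pos h, PathAlgebra.weightTrace_apply, PathAlgebra.weightMatrix_of]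
      simpa [QPath.trivial] using this
    · rw [idem, dif_neg h, map_zero]
  · have h : eps K n ^ (2 * n - 1) = aeval (eps K n) (X * X ^ (2 * n - 2) : K[X]) := by
      rw [← pow_succ', map_pow, aeval_X]
      congr 1
      omega
    have h' : τ ((lSystem K n p).ε ^ (2 * n - 1)) = t (X ^ (2 * n - 1)) := by
      change τ (RingQuot.mkAlgHom K _ (eps K n) ^ (2 * n - 1)) = _
      rw [← map_pow, hτ', h, PathAlgebra.weightTrace_apply, weightMatrix_aeval_eps n hn,
        Matrix.trace_single_eq_same, ← pow_succ']
      congr 2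
      omega
    rw [h']
    exact hne

end Trace

end DeformedL

theorem mainTheorem4 (K : Type*) [Field K] (n : ℕ) (hn : 1 ≤ n) (p : K[X]) :
    IsSelfDualSymmetricAlgebra K (DeformedPreprojectiveL K n p) := by
  obtain ⟨τ, hτ, he, hε⟩ := DeformedL.exists_traceForm K n p hn
  exact (DeformedL.lSystem K n p).isSelfDualSymmetricAlgebra hτ he hε
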